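/- Let $n\ge 0$ be an integer, let $\mathbb H$ be the real quaternions, and let $\mathrm{Mat}(n)$ be the ring of $n\times n$ quaternionic matrices, with $X^*=\overline{X}^{\,t}$. Let $\mathfrak p=\{X\in\mathrm{Mat}(n): X^*=X\}$, and let $\mathscr P\subseteq\mathfrak p$ be the open cone of those $X\in\mathfrak p$ for which $(Xv)^*v$ is a positive real number for every non-zero $v\in\mathbb H^n$. Let $\mathrm{trd}(X)=\sum_i \mathrm{Re}(X_{ii})$ be the reduced trace, and equip $\mathscr P$ with the Riemannian metric $$\omega_P(X,Y)=\mathrm{trd}\big(P^{-1}XP^{-1}Y\big),\qquad P\in\mathscr P,\ X,Y\in T_P\mathscr P\cong\mathfrak p .$$ For $X\in\mathscr P$ and $t\in\mathbb R$ put $X^t=\exp(t\log X)\in\mathscr P$, where $\log:\mathscr P\to\mathfrak p$ is the inverse of the bijection $\exp:\mathfrak p\to\mathscr P$. **Theorem.** Let $A,B\in\mathscr P$. There is exactly one geodesic $\gamma:[0,1]\to\mathscr P$ of $(\mathscr P,\omega)$ (that is, a smooth curve with $\nabla_{\dot\gamma}\dot\gamma=0$ for the Levi-Civita connection $\nabla$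 of $\omega$) with $\gamma(0)=A$ and $\gamma(1)=B$, and it is given by $$\gamma(t)=A^{1/2}\big(A^{-1/2}BA^{-1/2}\big)^{t}A^{1/2},\qquad t\in[0,1].$$ -/

import Mathlib

open scoped Quaternion Matrix ContDiff Matrix.Norms.Operator

noncomputable section

namespace QuatCone

/-- `Mat(n)`: square matrices with quaternion entries. Topology and norm are those of the
finite-dimensional real vector space (the norm chosen is the operator norm for the sup norm). -/
abbrev Mat (n : ℕ) : Type := Matrix (Fin n) (Fin n) ℍ[ℝ]

/-- The embedding `z₁ + z₂ j ↦ !![z₁, z₂; -conj z₂, conj z₁]` of the quaternions into `Mat(2, ℂ)`. -/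
def psi (q : ℍ[ℝ]) : Matrix (Fin 2) (Fin 2) ℂ :=
  !![⟨q.re, q.imI⟩, ⟨q.imJ, q.imK⟩; -star (⟨q.imJ, q.imK⟩ : ℂ), star (⟨q.re, q.imI⟩ : ℂ)]

/-- The reduced trace of a quaternion: half the trace of `psi q`, which is a real number
(see `trd_eq`). -/
def trd (q : ℍ[ℝ]) : ℝ := ((1 / 2 : ℂ) * (psi q).trace).re

theorem coe_trd (q : ℍ[ℝ]) : (trd q : ℂ) = (1 / 2 : ℂ) * (psi q).trace := by
  apply Complex.ext <;> simp [trd, psi, Matrix.trace_fin_two]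

theorem trd_eq (q : ℍ[ℝ]) : trd q = q.re := by
  simp [trd, psi, Matrix.trace_fin_two]
  ring

/-- The reduced trace of a quaternionic matrix. -/
def matTrd {n : ℕ} (X : Mat n) : ℝ := trd X.trace

/-- The real vector space `𝔭` of quaternionic Hermitian matrices, as a set. -/
def herm (n : ℕ) : Set (Mat n) := {X | Xᴴ = X}

/-- The standard Hermitian form `⟨x, y⟩ = x* y` on `ℍⁿ`. -/
def form {n : ℕ} (x y : Fin n → ℍ[ℝ]) : ℍ[ℝ] := star x ⬝ᵥ y

/-- A quaternion is positive if it is a positive real number. -/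
def IsPos (q : ℍ[ℝ]) : Prop := ∃ r : ℝ, 0 < r ∧ q = (r : ℍ[ℝ])

/-- The cone `𝒫` of positive quaternionic Hermitian matrices. -/
def cone (n : ℕ) : Set (Mat n) :=
  {X | X ∈ herm n ∧ ∀ v : Fin n → ℍ[ℝ], v ≠ 0 → IsPos (form (X *ᵥ v) v)}

/-- The logarithm of a positive matrix: the Hermitian matrix whose exponential it is, i.e.
the inverse of `exp : 𝔭 → 𝒫`. -/
def log {n : ℕ} (X : Mat n) : Mat n :=
  Function.invFunOn (fun H : Mat n => NormedSpace.exp H) (herm n) X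

/-- Real powers `Xᵗ = exp (t log X)` of a positive matrix. -/
def rpow {n : ℕ} (X : Mat n) (t : ℝ) : Mat n := NormedSpace.exp (t • log X)

/-- The Riemannian metric `ω_P(X, Y) = trd (P⁻¹ X P⁻¹ Y)` on `𝒫`, with `T_P 𝒫 = 𝔭`. Here
`Ring.inverse P` is the two-sided inverse of `P` in the ring of quaternionic matrices. -/
def omega {n : ℕ} (P X Y : Mat n) : ℝ := matTrd (Ring.inverse P * X * Ring.inverse P * Y)

/-- The Christoffel symbol of the first kind of `ω`, in the global chart `𝒫 ⊆ 𝔭`: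
`Γ_P(U, V; W) = ½ (D_U ω(V, W) + D_V ω(U, W) - D_W ω(U, V))` at `P`. By Koszul's formula for the
constant vector fields `U, V, W` (which commute), this is `ω_P(∇_U V, W)` for the
Levi-Civita connection `∇` of `ω`. -/
def christoffel {n : ℕ} (P U V W : Mat n) : ℝ :=
  (1 / 2) * (lineDeriv ℝ (fun Q => omega Q V W) P U
    + lineDeriv ℝ (fun Q => omega Q U W) P V
    - lineDeriv ℝ (fun Q => omega Q U V) P W)

/-- `a` is the value at time `t` of the covariant derivative, for the Levi-Civita
connection of `ω`, of the vector field `V` along the curve `γ : [0, 1] → 𝒫`; that is,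
`a = V' + Γ_γ(γ', V)`, written with the last index lowered by means of `ω`. -/
def IsCovDerivAt {n : ℕ} (γ V : ℝ → Mat n) (t : ℝ) (a : Mat n) : Prop :=
  a ∈ herm n ∧ ∀ W ∈ herm n,
    omega (γ t) a W
      = omega (γ t) (derivWithin V (Set.Icc 0 1) t) W
        + christoffel (γ t) (derivWithin γ (Set.Icc 0 1) t) (V t) W

/-- `γ`, restricted to `[0, 1]`, is a geodesic of `(𝒫, ω)`: a smooth curve in `𝒫` whose velocity is
parallel along it, `∇_{γ'} γ' = 0`. -/
def IsGeodesic {n : ℕ} (γ : ℝ → Mat n) : Prop :=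
  ContDiffOn ℝ ∞ γ (Set.Icc 0 1) ∧ Set.MapsTo γ (Set.Icc 0 1) (cone n) ∧
    ∀ t ∈ Set.Icc (0 : ℝ) 1, IsCovDerivAt γ (derivWithin γ (Set.Icc 0 1)) t 0

/-- `γ`, restricted to `[0, 1]`, is a geodesic of `(𝒫, ω)` joining `A` to `B`. -/
def IsGeodesicJoining {n : ℕ} (A B : Mat n) (γ : ℝ → Mat n) : Prop :=
  IsGeodesic γ ∧ γ 0 = A ∧ γ 1 = B

end QuatCone

end

namespace QuatCone

/-! In the global chart the Koszul formula turns `∇_{γ'} γ' = 0` into `P'' = P' P⁻¹ P'`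
(`christoffel_eq`, `isCovDerivAt_zero_iff`). This says exactly that `C = P⁻¹P'` is constant, so
`P(t) = P(0) exp(tC)` (`IsGeodesic.eq_mul_exp`). Writing `P(0) = S²`, conjugation by `S` gives `P(t)
= S exp(tH) S` with `H = S⁻¹P'(0)S⁻¹` Hermitian. The endpoint forces `exp H = S⁻¹BS⁻¹`, and `exp` is
injective on `𝔭`, so `H` is the logarithm. Conversely every such curve solves the equation
(`isGeodesic_mul_exp_mul`).

The bijection `exp : 𝔭 → 𝒫` comes from the real spectral theorem on `ℍⁿ` regarded as a real
Euclidean space, with Lagrange interpolation as functional calculus. -/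

noncomputable instance (n : ℕ) : NormedAlgebra ℚ (Mat n) := NormedAlgebra.restrictScalars ℚ ℝ (Mat n)

instance : StarModule ℝ ℍ[ℝ] := ⟨Quaternion.star_smul⟩

variable {n : ℕ}

/-! ### Positivity of the standard Hermitian form. -/

section Form

theorem form_self (w : Fin n → ℍ[ℝ]) :
    form w w = ((∑ i, Quaternion.normSq (w i) : ℝ) : ℍ[ℝ]) := by
  simp only [form, dotProduct, Pi.star_apply, Quaternion.star_mul_self]
  exact (map_sum (algebraMap ℝ ℍ[ℝ]) _ _).symm

theorem isPos_form_self {w : Fin n → ℍ[ℝ]} (hw : w ≠ 0) : IsPos (form w w) := by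
  refine ⟨_, ?_, form_self w⟩
  obtain ⟨i, hi⟩ := Function.ne_iff.1 hw
  refine Finset.sum_pos' (fun _ _ => Quaternion.normSq_nonneg) ⟨i, Finset.mem_univ _, ?_⟩
  exact lt_of_le_of_ne Quaternion.normSq_nonneg
    (fun h => hi (Quaternion.normSq_eq_zero.1 h.symm))

theorem form_mulVec_left (X : Mat n) (v w : Fin n → ℍ[ℝ]) :
    form (X *ᵥ v) w = form v (Xᴴ *ᵥ w) := by
  rw [form, form, Matrix.star_mulVec, Matrix.dotProduct_mulVec]

theorem conjTranspose_mul_self_mem_cone {M : Mat n} (hM : IsUnit M) : Mᴴ * M ∈ cone n := by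
  refine ⟨Matrix.isHermitian_conjTranspose_mul_self M, fun v hv => ?_⟩
  have hMv : M *ᵥ v ≠ 0 := by
    obtain ⟨u, rfl⟩ := hM
    intro h
    apply hv
    rw [← Matrix.one_mulVec v, ← u.inv_mul, ← Matrix.mulVec_mulVec, h, Matrix.mulVec_zero]
  rw [form_mulVec_left, Matrix.conjTranspose_mul, Matrix.conjTranspose_conjTranspose,
    ← Matrix.mulVec_mulVec, ← Matrix.conjTranspose_conjTranspose M, ← form_mulVec_left,
    Matrix.conjTranspose_conjTranspose]
  exact isPos_form_self hMv

end Form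

/-! ### Spectral theory and the logarithm. -/

section Spectral

/-- The real-linear operator on the Euclidean space `ℍⁿ` given by a quaternionic matrix. -/
def toLin (X : Mat n) : PiLp 2 (fun _ : Fin n => ℍ[ℝ]) →ₗ[ℝ] PiLp 2 (fun _ : Fin n => ℍ[ℝ]) where
  toFun v := WithLp.toLp 2 (X *ᵥ v.ofLp)
  map_add' v w := by simp [Matrix.mulVec_add]
  map_smul' r v := by simp [Matrix.mulVec_smul]

theorem inner_eq_re_form (v w : PiLp 2 (fun _ : Fin n => ℍ[ℝ])) :
    inner ℝ v w = (form v.ofLp w.ofLp).re := by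
  rw [PiLp.inner_apply, form, dotProduct,
    show (∑ i, star v.ofLp i * w.ofLp i).re = ∑ i, (star v.ofLp i * w.ofLp i).re from
      map_sum (QuaternionAlgebra.reₗ (-1 : ℝ) 0 (-1)) _ _]
  refine Finset.sum_congr rfl fun i _ => ?_
  rw [Quaternion.inner_def, ← Quaternion.re_star]
  simp only [star_mul, star_star, Quaternion.re_mul, Quaternion.re_star, Quaternion.imI_star,
    Quaternion.imJ_star, Quaternion.imK_star, Pi.star_apply]
  ring

theorem toLin_isSymmetric {X : Mat n} (hX : X ∈ herm n) : (toLin X).IsSymmetric := by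
  intro v w
  rw [inner_eq_re_form, inner_eq_re_form]
  change (form (X *ᵥ v.ofLp) w.ofLp).re = (form v.ofLp (X *ᵥ w.ofLp)).re
  rw [form_mulVec_left, show Xᴴ = X from hX]

/-- `v` is a real basis of `ℍⁿ` consisting of eigenvectors of `X` with real eigenvalues `μ`. -/
structure IsEigenbasis {ι : Type*} (X : Mat n) (v : ι → Fin n → ℍ[ℝ]) (μ : ι → ℝ) : Prop where
  ne_zero : ∀ i, v i ≠ 0
  apply : ∀ i, X *ᵥ v i = μ i • v i
  ext : ∀ Y Z : Mat n, (∀ i, Y *ᵥ v i = Z *ᵥ v i) → Y = Z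

/-- A Hermitian `X` is symmetric for the real inner product `Re (v* w)`, so no quaternionic spectral
theorem is needed. -/
theorem exists_isEigenbasis {X : Mat n} (hX : X ∈ herm n) :
    ∃ (m : ℕ) (v : Fin m → Fin n → ℍ[ℝ]) (μ : Fin m → ℝ), IsEigenbasis X v μ := by
  have hs := toLin_isSymmetric hX
  let b := hs.eigenvectorBasis rfl
  refine ⟨_, fun i => (b i).ofLp, hs.eigenvalues rfl, ?_, ?_, ?_⟩
  · intro i h
    exact b.toBasis.ne_zero i (by
      rw [OrthonormalBasis.coe_toBasis]; exact (WithLp.ofLp_eq_zero 2).1 h)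
  · intro i
    exact congrArg WithLp.ofLp (hs.apply_eigenvectorBasis rfl i)
  · intro Y Z h
    have hl : toLin Y = toLin Z := b.toBasis.ext fun i => by
      rw [OrthonormalBasis.coe_toBasis]; exact congrArg (WithLp.toLp 2) (h i)
    ext1 i j
    have := congrArg WithLp.ofLp (LinearMap.congr_fun hl (WithLp.toLp 2 (Pi.single j 1)))
    simpa [toLin] using congrFun this i

theorem pow_mulVec_of_eigen {X : Mat n} {v : Fin n → ℍ[ℝ]} {μ : ℝ} (h : X *ᵥ v = μ • v) (k : ℕ) :
    (X ^ k) *ᵥ v = μ ^ k • v := by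
  induction k with
  | zero => simp
  | succ k ih => rw [pow_succ, ← Matrix.mulVec_mulVec, h, Matrix.mulVec_smul, ih, smul_smul,
      pow_succ, mul_comm]

theorem aeval_mulVec_of_eigen {X : Mat n} {v : Fin n → ℍ[ℝ]} {μ : ℝ} (h : X *ᵥ v = μ • v)
    (p : Polynomial ℝ) : (Polynomial.aeval X p) *ᵥ v = p.eval μ • v := by
  rw [Polynomial.aeval_eq_sum_range, Polynomial.eval_eq_sum_range, Matrix.sum_mulVec,
    Finset.sum_smul]
  refine Finset.sum_congr rfl fun k _ => ?_
  rw [Matrix.smul_mulVec, pow_mulVec_of_eigen h, smul_smul]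

theorem exp_mulVec_of_eigen {X : Mat n} {v : Fin n → ℍ[ℝ]} {μ : ℝ} (h : X *ᵥ v = μ • v) :
    NormedSpace.exp X *ᵥ v = Real.exp μ • v := by
  have h1 := NormedSpace.exp_series_hasSum_exp' (𝕂 := ℝ) X
  have h2 := NormedSpace.exp_series_hasSum_exp' (𝕂 := ℝ) μ
  rw [← Real.exp_eq_exp_ℝ] at h2
  let f : Mat n →+ (Fin n → ℍ[ℝ]) :=
    { toFun := fun Y => Y *ᵥ v
      map_zero' := Matrix.zero_mulVec v
      map_add' := fun Y Z => Matrix.add_mulVec Y Z v }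
  have hf : Continuous f := continuous_id.matrix_mulVec continuous_const
  have h3 := h1.map f hf
  have h4 := h2.smul_const v
  refine h3.unique (h4.congr_fun ?_)
  intro k
  simp only [Function.comp, f, AddMonoidHom.coe_mk, ZeroHom.coe_mk, Matrix.smul_mulVec,
    pow_mulVec_of_eigen h, smul_smul, smul_eq_mul]

theorem exists_polynomial_eval_eq (s : Finset ℝ) (f : ℝ → ℝ) :
    ∃ p : Polynomial ℝ, ∀ x ∈ s, p.eval x = f x :=
  ⟨Lagrange.interpolate s id f, fun _ hx =>
    Lagrange.eval_interpolate_at_node f Function.injective_id.injOn hx⟩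

theorem aeval_mem_herm {X : Mat n} (hX : X ∈ herm n) (p : Polynomial ℝ) :
    Polynomial.aeval X p ∈ herm n := by
  change (Polynomial.aeval X p)ᴴ = _
  rw [Polynomial.aeval_eq_sum_range, Matrix.conjTranspose_sum]
  refine Finset.sum_congr rfl fun k _ => ?_
  rw [Matrix.conjTranspose_smul, Matrix.conjTranspose_pow, show Xᴴ = X from hX, star_trivial]

theorem eigenvalue_pos {X : Mat n} (hX : X ∈ cone n) {v : Fin n → ℍ[ℝ]} (hv : v ≠ 0) {μ : ℝ}
    (h : X *ᵥ v = μ • v) : 0 < μ := by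
  obtain ⟨r, hr, e⟩ := hX.2 v hv
  obtain ⟨s, hs, e'⟩ := isPos_form_self hv
  have : form (μ • v) v = μ • form v v := by
    rw [form, star_smul, smul_dotProduct, star_trivial, form]
  rw [h, this, e'] at e
  have e2 : μ * s = r := by simpa using congrArg QuaternionAlgebra.re e
  exact pos_of_mul_pos_left (e2 ▸ hr) hs.le

theorem exists_exp_eq {X : Mat n} (hX : X ∈ cone n) : ∃ H ∈ herm n, NormedSpace.exp H = X := by
  obtain ⟨m, v, μ, hb⟩ := exists_isEigenbasis hX.1
  -- The candidate logarithm is a real polynomial in `X`, hence Hermitian with the same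
  -- eigenvectors.
  obtain ⟨p, hp⟩ := exists_polynomial_eval_eq (Finset.univ.image μ) Real.log
  refine ⟨Polynomial.aeval X p, aeval_mem_herm hX.1 p, hb.ext _ _ fun i => ?_⟩
  rw [exp_mulVec_of_eigen (aeval_mulVec_of_eigen (hb.apply i) p),
    hp _ (Finset.mem_image_of_mem _ (Finset.mem_univ i)),
    Real.exp_log (eigenvalue_pos hX (hb.ne_zero i) (hb.apply i)), hb.apply]

/-- One polynomial, equal to the logarithm on the exponentials of both spectra, recovers each matrix
from its exponential. -/
theorem exp_injOn_herm :
    Set.InjOn (fun H : Mat n => NormedSpace.exp H) (herm n) := by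
  intro X hX Y hY hXY
  obtain ⟨m, v, μ, hb⟩ := exists_isEigenbasis hX
  obtain ⟨l, w, ν, hc⟩ := exists_isEigenbasis hY
  obtain ⟨p, hp⟩ := exists_polynomial_eval_eq
    ((Finset.univ.image μ ∪ Finset.univ.image ν).image Real.exp) Real.log
  have hp' : ∀ x ∈ Finset.univ.image μ ∪ Finset.univ.image ν, p.eval (Real.exp x) = x :=
    fun x hx => by rw [hp _ (Finset.mem_image_of_mem _ hx), Real.log_exp]
  have h1 : Polynomial.aeval (NormedSpace.exp X) p = X := hb.ext _ _ fun i => by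
    rw [aeval_mulVec_of_eigen (exp_mulVec_of_eigen (hb.apply i)), hp' _ (by simp), hb.apply]
  have h2 : Polynomial.aeval (NormedSpace.exp Y) p = Y := hc.ext _ _ fun i => by
    rw [aeval_mulVec_of_eigen (exp_mulVec_of_eigen (hc.apply i)), hp' _ (by simp), hc.apply]
  rw [← h1, ← h2]
  exact congrArg (fun Z : Mat n => Polynomial.aeval Z p) hXY

theorem log_mem_herm {X : Mat n} (hX : X ∈ cone n) : log X ∈ herm n :=
  Function.invFunOn_mem (exists_exp_eq hX)

theorem exp_log {X : Mat n} (hX : X ∈ cone n) : NormedSpace.exp (log X) = X :=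
  Function.invFunOn_eq (exists_exp_eq hX)

theorem log_exp {H : Mat n} (hH : H ∈ herm n) : log (NormedSpace.exp H) = H :=
  exp_injOn_herm.leftInvOn_invFunOn hH

end Spectral

/-! ### One-parameter groups and positivity. -/

section Power

theorem smul_mem_herm {H : Mat n} (hH : H ∈ herm n) (t : ℝ) : t • H ∈ herm n := by
  change (t • H)ᴴ = _
  rw [Matrix.conjTranspose_smul, show Hᴴ = H from hH, star_trivial]

theorem exp_mem_herm {H : Mat n} (hH : H ∈ herm n) : NormedSpace.exp H ∈ herm n :=
  Matrix.IsHermitian.exp hH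

theorem exp_add_smul (H : Mat n) (s t : ℝ) :
    NormedSpace.exp ((s + t) • H) = NormedSpace.exp (s • H) * NormedSpace.exp (t • H) := by
  rw [add_smul]
  exact NormedSpace.exp_add_of_commute (((Commute.refl H).smul_left s).smul_right t)

theorem exp_smul_mul_exp_neg_smul (H : Mat n) (t : ℝ) :
    NormedSpace.exp (t • H) * NormedSpace.exp ((-t) • H) = 1 := by
  rw [← exp_add_smul, add_neg_cancel, zero_smul, NormedSpace.exp_zero]

theorem exp_neg_smul_mul_exp_smul (H : Mat n) (t : ℝ) :
    NormedSpace.exp ((-t) • H) * NormedSpace.exp (t • H) = 1 := by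
  rw [← exp_add_smul, neg_add_cancel, zero_smul, NormedSpace.exp_zero]

theorem exp_half_mul_self (H : Mat n) :
    NormedSpace.exp ((1 / 2 : ℝ) • H) * NormedSpace.exp ((1 / 2 : ℝ) • H) = NormedSpace.exp H := by
  rw [← exp_add_smul]; norm_num

/-- `S (exp H) S` is positive for `S` Hermitian and invertible and `H` Hermitian. -/
theorem mul_exp_mul_mem_cone {S H : Mat n} (hS : S ∈ herm n) (hu : IsUnit S) (hH : H ∈ herm n) :
    S * NormedSpace.exp H * S ∈ cone n := by
  -- With `E = exp(H/2)`, the product is `(ES)*(ES)`.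
  have hE : IsUnit (NormedSpace.exp ((1 / 2 : ℝ) • H)) := NormedSpace.isUnit_exp _
  have h := conjTranspose_mul_self_mem_cone (hE.mul hu)
  have he : (NormedSpace.exp ((1 / 2 : ℝ) • H))ᴴ = NormedSpace.exp ((1 / 2 : ℝ) • H) :=
    exp_mem_herm (smul_mem_herm hH _)
  rw [Matrix.conjTranspose_mul, show Sᴴ = S from hS, he] at h
  rwa [← exp_half_mul_self H, mul_assoc, mul_assoc, ← mul_assoc S]

theorem isUnit_of_mem_cone {X : Mat n} (hX : X ∈ cone n) : IsUnit X := by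
  rw [← exp_log hX]; exact NormedSpace.isUnit_exp _

end Power

/-! ### The reduced trace form. -/

section Trace

theorem matTrd_eq (X : Mat n) : matTrd X = X.trace.re := trd_eq _

/-- The reduced trace as a continuous linear map. -/
noncomputable def matTrdL (n : ℕ) : Mat n →L[ℝ] ℝ :=
  LinearMap.toContinuousLinearMap
    { toFun := matTrd
      map_add' := fun X Y => by simp [matTrd_eq, Matrix.trace_add]
      map_smul' := fun r X => by simp [matTrd_eq, Matrix.trace_smul] }

theorem matTrdL_apply (X : Mat n) : matTrdL n X = matTrd X := rfl

theorem matTrd_add (X Y : Mat n) : matTrd (X + Y) = matTrd X + matTrd Y :=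
  (matTrdL n).map_add X Y

theorem matTrd_neg (X : Mat n) : matTrd (-X) = -matTrd X := (matTrdL n).map_neg X

theorem matTrd_sub (X Y : Mat n) : matTrd (X - Y) = matTrd X - matTrd Y :=
  (matTrdL n).map_sub X Y

theorem matTrd_zero : matTrd (0 : Mat n) = 0 := (matTrdL n).map_zero

theorem re_trace (X : Mat n) : X.trace.re = ∑ i, (X i i).re :=
  map_sum (QuaternionAlgebra.reₗ (-1 : ℝ) 0 (-1)) _ _

theorem re_mul_apply (X Y : Mat n) (i j : Fin n) :
    ((X * Y) i j).re = ∑ k, (X i k * Y k j).re :=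
  map_sum (QuaternionAlgebra.reₗ (-1 : ℝ) 0 (-1)) _ _

/-- Quaternions do not commute, but `Re (ab) = Re (ba)`. -/
theorem matTrd_mul_comm (X Y : Mat n) : matTrd (X * Y) = matTrd (Y * X) := by
  simp only [matTrd_eq, re_trace, re_mul_apply]
  rw [Finset.sum_comm]
  refine Finset.sum_congr rfl fun i _ => Finset.sum_congr rfl fun j _ => ?_
  simp only [Quaternion.re_mul]
  ring

/-- For Hermitian `Z` the trace of `Z²` is the sum of the squared norms of the entries. -/
theorem eq_zero_of_matTrd_mul_self {Z : Mat n} (hZ : Z ∈ herm n) (h : matTrd (Z * Z) = 0) :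
    Z = 0 := by
  have h1 : matTrd (Z * Z) = ∑ i, ∑ k, Quaternion.normSq (Z i k) := by
    simp only [matTrd_eq, re_trace, re_mul_apply]
    refine Finset.sum_congr rfl fun i _ => Finset.sum_congr rfl fun k _ => ?_
    rw [show Z k i = star (Z i k) from (congrFun (congrFun hZ k) i).symm,
      Quaternion.self_mul_star, Quaternion.re_coe]
  rw [h1] at h
  ext1 i k
  have h2 := (Finset.sum_eq_zero_iff_of_nonneg
    fun i _ => Finset.sum_nonneg fun k _ => Quaternion.normSq_nonneg).1 h i (Finset.mem_univ i)
  exact Quaternion.normSq_eq_zero.1 ((Finset.sum_eq_zero_iff_of_nonneg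
    fun k _ => Quaternion.normSq_nonneg).1 h2 k (Finset.mem_univ k))

end Trace

/-! ### Christoffel symbols and the geodesic equation. -/

section Metric

theorem ringInverse_eq_of_mul_eq_one {X Y : Mat n} (h : X * Y = 1) (h' : Y * X = 1) :
    Ring.inverse X = Y :=
  Ring.inverse_unit (⟨X, Y, h, h'⟩ : (Mat n)ˣ)

theorem hasDerivWithinAt_ringInverse {γ : ℝ → Mat n} {γ' : Mat n} {s : Set ℝ} {t : ℝ}
    (h : HasDerivWithinAt γ γ' s t) (hu : IsUnit (γ t)) :
    HasDerivWithinAt (fun τ => Ring.inverse (γ τ))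
      (-(Ring.inverse (γ t) * γ' * Ring.inverse (γ t))) s t := by
  obtain ⟨u, hu⟩ := hu
  have h1 : HasFDerivAt Ring.inverse (-ContinuousLinearMap.mulLeftRight ℝ (Mat n) ↑u⁻¹ ↑u⁻¹)
      (γ t) := hu ▸ hasFDerivAt_ringInverse u
  have h2 := h1.comp_hasDerivWithinAt t h
  rw [← hu, Ring.inverse_unit]
  exact h2

theorem lineDeriv_omega {P : Mat n} (hP : IsUnit P) (U V W : Mat n) :
    lineDeriv ℝ (fun Q => omega Q V W) P U
      = -matTrd (Ring.inverse P * U * Ring.inverse P * V * Ring.inverse P * W)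
        - matTrd (Ring.inverse P * V * Ring.inverse P * U * Ring.inverse P * W) := by
  have h0 : HasDerivWithinAt (fun t : ℝ => P + t • U) U Set.univ 0 := by
    have h := (((hasDerivAt_id (0 : ℝ)).smul_const U).const_add P).hasDerivWithinAt (s := Set.univ)
    rwa [one_smul] at h
  have h1 := hasDerivWithinAt_ringInverse h0 (by simpa using hP)
  simp only [zero_smul, add_zero] at h1
  have h2 := ((h1.mul_const V).mul h1).mul_const W
  have h3 := (matTrdL n).hasFDerivAt.comp_hasDerivWithinAt 0 h2
  rw [hasDerivWithinAt_univ] at h3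
  refine h3.deriv.trans ((matTrdL_apply _).trans ?_)
  simp only [zero_smul, add_zero, neg_mul, mul_neg, add_mul, matTrd_add, matTrd_neg, ← mul_assoc]
  ring

/-- By cyclicity of the trace, the two terms of the `W`-derivative cancel half of the other four. -/
theorem christoffel_eq {P : Mat n} (hP : IsUnit P) (U V W : Mat n) :
    christoffel P U V W
      = -(1 / 2) * (matTrd (Ring.inverse P * U * Ring.inverse P * V * Ring.inverse P * W)
        + matTrd (Ring.inverse P * V * Ring.inverse P * U * Ring.inverse P * W)) := by
  rw [christoffel, lineDeriv_omega hP, lineDeriv_omega hP, lineDeriv_omega hP]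
  generalize Ring.inverse P = R
  have h1 : matTrd (R * W * R * U * R * V) = matTrd (R * U * R * V * R * W) := by
    rw [show R * W * R * U * R * V = (R * W) * (R * U * R * V) by simp only [mul_assoc],
      matTrd_mul_comm]
    simp only [mul_assoc]
  have h2 : matTrd (R * U * R * W * R * V) = matTrd (R * V * R * U * R * W) := by
    rw [show R * U * R * W * R * V = (R * U * R * W) * (R * V) by simp only [mul_assoc],
      matTrd_mul_comm]
    simp only [mul_assoc]
  rw [h1, h2]
  ring

theorem ringInverse_mem_herm {P : Mat n} (hP : P ∈ herm n) : Ring.inverse P ∈ herm n :=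
  (Ring.inverse_star P).symm.trans (congrArg Ring.inverse hP)

theorem mul_mul_mem_herm {X Y : Mat n} (hX : X ∈ herm n) (hY : Y ∈ herm n) :
    X * Y * X ∈ herm n := by
  change (X * Y * X)ᴴ = _
  rw [Matrix.conjTranspose_mul, Matrix.conjTranspose_mul, show Xᴴ = X from hX,
    show Yᴴ = Y from hY, mul_assoc]

theorem sub_mem_herm {X Y : Mat n} (hX : X ∈ herm n) (hY : Y ∈ herm n) :
    X - Y ∈ herm n := by
  change (X - Y)ᴴ = _
  rw [Matrix.conjTranspose_sub, show Xᴴ = X from hX, show Yᴴ = Y from hY]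

/-- The geodesic equation `P'' = P' P⁻¹ P'` is the vanishing of the covariant derivative. -/
theorem isCovDerivAt_zero_iff {γ : ℝ → Mat n} {t : ℝ} (hγ : γ t ∈ cone n) {a b : Mat n}
    (hb : derivWithin γ (Set.Icc 0 1) t = b)
    (ha : derivWithin (derivWithin γ (Set.Icc 0 1)) (Set.Icc 0 1) t = a)
    (h1 : b ∈ herm n) (h2 : a ∈ herm n) :
    IsCovDerivAt γ (derivWithin γ (Set.Icc 0 1)) t 0 ↔ a = b * Ring.inverse (γ t) * b := by
  have hu := isUnit_of_mem_cone hγ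
  rw [IsCovDerivAt, ha, hb]
  have hR := ringInverse_mem_herm hγ.1
  have key : ∀ W, omega (γ t) a W + christoffel (γ t) b b W
      = matTrd ((Ring.inverse (γ t) * (a - b * Ring.inverse (γ t) * b) * Ring.inverse (γ t))
          * W) := by
    intro W
    rw [christoffel_eq hu, omega]
    simp only [mul_sub, sub_mul, ← mul_assoc]
    rw [matTrd_sub]
    ring
  simp only [key]
  constructor
  · rintro ⟨-, h⟩
    -- This matrix is itself an admissible test vector `W`, so definiteness of the trace form makes
    -- it vanish.
    have hZ : Ring.inverse (γ t) * (a - b * Ring.inverse (γ t) * b) * Ring.inverse (γ t)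
        ∈ herm n := mul_mul_mem_herm hR (sub_mem_herm h2 (mul_mul_mem_herm h1 hR))
    have h0 := (h _ hZ).symm
    rw [omega, mul_zero, zero_mul, zero_mul, matTrd_zero] at h0
    have hz := eq_zero_of_matTrd_mul_self hZ h0
    have : γ t * (Ring.inverse (γ t) * (a - b * Ring.inverse (γ t) * b) * Ring.inverse (γ t))
        * γ t = 0 := by rw [hz, mul_zero, zero_mul]
    rw [mul_assoc, mul_assoc, Ring.inverse_mul_cancel _ hu, mul_one, ← mul_assoc,
      Ring.mul_inverse_cancel _ hu, one_mul] at this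
    exact sub_eq_zero.1 this
  · intro h
    refine ⟨Matrix.conjTranspose_zero, fun W _ => ?_⟩
    rw [← h, sub_self, omega]

end Metric

/-! ### Calculus of Hermitian curves on `[0, 1]`. -/

section Derivatives

instance : @ContinuousStar (Mat n) PseudoMetricSpace.toUniformSpace.toTopologicalSpace _ :=
  ⟨continuous_id.matrix_conjTranspose⟩

theorem derivWithin_mem_herm {γ : ℝ → Mat n} {s : Set ℝ} (h : Set.MapsTo γ s (herm n)) :
    Set.MapsTo (derivWithin γ s) s (herm n) := by
  intro t ht
  have h1 : derivWithin (fun τ => star (γ τ)) s t = star (derivWithin γ s t) := derivWithin.star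
  exact h1.symm.trans (derivWithin_congr (fun τ hτ => h hτ) (h ht))

theorem hasDerivWithinAt_of_contDiffOn {γ : ℝ → Mat n} (h : ContDiffOn ℝ ∞ γ (Set.Icc 0 1))
    {t : ℝ} (ht : t ∈ Set.Icc (0 : ℝ) 1) :
    HasDerivWithinAt γ (derivWithin γ (Set.Icc 0 1) t) (Set.Icc 0 1) t :=
  ((h.differentiableOn (by simp)) t ht).hasDerivWithinAt

theorem contDiffOn_derivWithin {γ : ℝ → Mat n} (h : ContDiffOn ℝ ∞ γ (Set.Icc 0 1)) :
    ContDiffOn ℝ ∞ (derivWithin γ (Set.Icc 0 1)) (Set.Icc 0 1) :=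
  h.derivWithin (uniqueDiffOn_Icc zero_lt_one) (by simp)

theorem eq_of_hasDerivWithinAt_zero {F : ℝ → Mat n}
    (h : ∀ t ∈ Set.Icc (0 : ℝ) 1, HasDerivWithinAt F 0 (Set.Icc 0 1) t) :
    ∀ t ∈ Set.Icc (0 : ℝ) 1, F t = F 0 :=
  constant_of_derivWithin_zero (fun t ht => (h t ht).differentiableWithinAt)
    fun t ht => (h t (Set.Ico_subset_Icc_self ht)).derivWithin
      (uniqueDiffOn_Icc zero_lt_one t (Set.Ico_subset_Icc_self ht))

end Derivatives

/-! ### Solving the geodesic equation. -/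

section Geodesics

/-- A solution of `P'' = P' P⁻¹ P'` is `t ↦ P(0) exp(t C)` with `C = P(0)⁻¹ P'(0)`. -/
theorem IsGeodesic.eq_mul_exp {γ : ℝ → Mat n} (h : IsGeodesic γ) :
    ∀ t ∈ Set.Icc (0 : ℝ) 1, γ t = γ 0 *
      NormedSpace.exp (t • (Ring.inverse (γ 0) * derivWithin γ (Set.Icc 0 1) 0)) := by
  obtain ⟨hs, hc, hcov⟩ := h
  have hd := fun t ht => hasDerivWithinAt_of_contDiffOn hs (t := t) ht
  have hdd := fun t ht => hasDerivWithinAt_of_contDiffOn (contDiffOn_derivWithin hs) (t := t) ht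
  have hh := derivWithin_mem_herm fun t ht => (hc ht).1
  have hhh := derivWithin_mem_herm hh
  have hu : ∀ t ∈ Set.Icc (0 : ℝ) 1, IsUnit (γ t) := fun t ht => isUnit_of_mem_cone (hc ht)
  -- Conserved quantity: `(P⁻¹P')' = P⁻¹(P'' - P'P⁻¹P') = 0`.
  have hC := eq_of_hasDerivWithinAt_zero
    (F := fun t => Ring.inverse (γ t) * derivWithin γ (Set.Icc 0 1) t) fun t ht => by
      have e := (isCovDerivAt_zero_iff (hc ht) rfl rfl (hh ht) (hhh ht)).1 (hcov t ht)
      refine ((hasDerivWithinAt_ringInverse (hd t ht) (hu t ht)).mul (hdd t ht)).congr_deriv ?_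
      rw [e]
      simp only [neg_mul, mul_assoc, neg_add_cancel]
  set C := Ring.inverse (γ 0) * derivWithin γ (Set.Icc 0 1) 0
  have hd' : ∀ t ∈ Set.Icc (0 : ℝ) 1, derivWithin γ (Set.Icc 0 1) t = γ t * C := fun t ht => by
    rw [← show _ = C from hC t ht, ← mul_assoc, Ring.mul_inverse_cancel _ (hu t ht), one_mul]
  -- Integrating factor for the linear equation `P' = PC`.
  have hF := eq_of_hasDerivWithinAt_zero
    (F := fun t => γ t * NormedSpace.exp (t • (-C))) fun t ht => by
      refine ((hd t ht).mul
        (hasDerivAt_exp_smul_const' (-C) t).hasDerivWithinAt).congr_deriv ?_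
      rw [hd' t ht]
      simp only [neg_mul, mul_neg, mul_assoc, add_neg_cancel]
  intro t ht
  have h1 : γ t * NormedSpace.exp ((-t) • C) = γ 0 := by
    have := hF t ht
    simpa only [smul_neg, neg_smul, zero_smul, neg_zero, NormedSpace.exp_zero, mul_one] using this
  rw [← h1, mul_assoc, exp_neg_smul_mul_exp_smul, mul_one]

theorem contDiff_exp_smul (H : Mat n) : ContDiff ℝ ∞ fun t : ℝ => NormedSpace.exp (t • H) := by
  have h : ContDiff ℝ ∞ (NormedSpace.exp : Mat n → Mat n) :=
    contDiff_iff_contDiffAt.2 fun x => (NormedSpace.exp_analytic (𝕂 := ℝ) x).contDiffAt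
  exact h.comp (contDiff_id.smul contDiff_const)

theorem exp_smul_units_conj {S T : Mat n} (hST : S * T = 1) (hTS : T * S = 1) (X : Mat n) :
    NormedSpace.exp (S * X * T) = S * NormedSpace.exp X * T :=
  NormedSpace.exp_units_conj (⟨S, T, hST, hTS⟩ : (Mat n)ˣ) X

theorem isGeodesic_mul_exp_mul {S H : Mat n} (hS : S ∈ herm n) (hu : IsUnit S) (hH : H ∈ herm n) :
    IsGeodesic fun t : ℝ => S * NormedSpace.exp (t • H) * S := by
  have hd : ∀ t : ℝ, HasDerivAt (fun t : ℝ => S * NormedSpace.exp (t • H) * S)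
      (S * (NormedSpace.exp (t • H) * H) * S) t := fun t =>
    ((hasDerivAt_exp_smul_const H t).const_mul S).mul_const S
  have hdd : ∀ t : ℝ, HasDerivAt (fun t : ℝ => S * (NormedSpace.exp (t • H) * H) * S)
      (S * (NormedSpace.exp (t • H) * H * H) * S) t := fun t =>
    (((hasDerivAt_exp_smul_const H t).mul_const H).const_mul S).mul_const S
  have hU : UniqueDiffOn ℝ (Set.Icc (0 : ℝ) 1) := uniqueDiffOn_Icc zero_lt_one
  have e1 : Set.EqOn (derivWithin (fun t : ℝ => S * NormedSpace.exp (t • H) * S) (Set.Icc 0 1))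
      (fun t => S * (NormedSpace.exp (t • H) * H) * S) (Set.Icc 0 1) := fun t ht =>
    (hd t).hasDerivWithinAt.derivWithin (hU t ht)
  have hc : Set.MapsTo (fun t : ℝ => S * NormedSpace.exp (t • H) * S) (Set.Icc 0 1) (cone n) :=
    fun t _ => mul_exp_mul_mem_cone hS hu (smul_mem_herm hH t)
  have hh := derivWithin_mem_herm fun t ht => (hc ht).1
  refine ⟨((contDiff_const.mul (contDiff_exp_smul H)).mul contDiff_const).contDiffOn, hc,
    fun t ht => (isCovDerivAt_zero_iff (hc ht) (e1 ht) ((derivWithin_congr e1 (e1 ht)).trans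
      ((hdd t).hasDerivWithinAt.derivWithin (hU t ht))) (e1 ht ▸ hh ht) ?_).2 ?_⟩
  · rw [← (hdd t).hasDerivWithinAt.derivWithin (hU t ht), ← derivWithin_congr e1 (e1 ht)]
    exact derivWithin_mem_herm hh ht
  -- With `E = exp(tH)`: `(SEHS)(S⁻¹E⁻¹S⁻¹)(SEHS) = SEHHS`, the second derivative.
  change _ = _ * Ring.inverse (S * NormedSpace.exp (t • H) * S) * _
  obtain ⟨u, rfl⟩ := hu
  have a1 : ∀ X : Mat n, (u : Mat n) * ((↑u⁻¹ : Mat n) * X) = X := u.mul_inv_cancel_left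
  have a2 : ∀ X : Mat n, (↑u⁻¹ : Mat n) * (u * X) = X := u.inv_mul_cancel_left
  have a3 : ∀ X : Mat n, NormedSpace.exp ((-t) • H) * (NormedSpace.exp (t • H) * X) = X :=
    fun X => by rw [← mul_assoc, exp_neg_smul_mul_exp_smul, one_mul]
  have a4 : ∀ X : Mat n, NormedSpace.exp (t • H) * (NormedSpace.exp ((-t) • H) * X) = X :=
    fun X => by rw [← mul_assoc, exp_smul_mul_exp_neg_smul, one_mul]
  have hinv : Ring.inverse ((u : Mat n) * NormedSpace.exp (t • H) * u)
      = (↑u⁻¹ : Mat n) * NormedSpace.exp ((-t) • H) * (↑u⁻¹ : Mat n) := by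
    apply ringInverse_eq_of_mul_eq_one
    · simp only [mul_assoc, a1, a4, Units.mul_inv]
    · simp only [mul_assoc, a2, a3, Units.inv_mul]
  rw [hinv]
  simp only [mul_assoc, a1, a2, a3]

end Geodesics

/-! ### Real powers and the endpoint conditions. -/

section Joining

theorem rpow_zero (X : Mat n) : rpow X 0 = 1 := by
  rw [rpow, zero_smul, NormedSpace.exp_zero]

theorem rpow_one {X : Mat n} (hX : X ∈ cone n) : rpow X 1 = X := by
  rw [rpow, one_smul, exp_log hX]

theorem rpow_mem_herm {X : Mat n} (hX : X ∈ cone n) (t : ℝ) : rpow X t ∈ herm n :=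
  exp_mem_herm (smul_mem_herm (log_mem_herm hX) t)

theorem isUnit_rpow (X : Mat n) (t : ℝ) : IsUnit (rpow X t) := NormedSpace.isUnit_exp _

theorem rpow_half_mul_self {X : Mat n} (hX : X ∈ cone n) :
    rpow X (1 / 2) * rpow X (1 / 2) = X := (exp_half_mul_self _).trans (exp_log hX)

theorem rpow_mul_rpow_neg (X : Mat n) (t : ℝ) : rpow X t * rpow X (-t) = 1 :=
  exp_smul_mul_exp_neg_smul _ t

theorem rpow_neg_mul_rpow (X : Mat n) (t : ℝ) : rpow X (-t) * rpow X t = 1 :=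
  exp_neg_smul_mul_exp_smul _ t

theorem mul_mul_mem_cone {S X : Mat n} (hS : S ∈ herm n) (hu : IsUnit S) (hX : X ∈ cone n) :
    S * X * S ∈ cone n := by
  have h := mul_exp_mul_mem_cone hS hu (log_mem_herm hX)
  rwa [exp_log hX] at h

/-- A geodesic from `S²`, with `S T = T S = 1`, is `t ↦ S exp(t H) S` with `H = T γ'(0) T`. -/
theorem IsGeodesic.eq_mul_exp_mul {γ : ℝ → Mat n} (h : IsGeodesic γ) {S T : Mat n}
    (hST : S * T = 1) (hTS : T * S = 1) (h0 : γ 0 = S * S) :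
    ∀ t ∈ Set.Icc (0 : ℝ) 1, γ t =
      S * NormedSpace.exp (t • (T * derivWithin γ (Set.Icc 0 1) 0 * T)) * S := by
  intro t ht
  have hinv : Ring.inverse (γ 0) = T * T := by
    rw [h0]
    apply ringInverse_eq_of_mul_eq_one
    · rw [mul_assoc, ← mul_assoc S T, hST, one_mul, hST]
    · rw [mul_assoc, ← mul_assoc T S, hTS, one_mul, hTS]
  rw [h.eq_mul_exp t ht, hinv, h0]
  generalize derivWithin γ (Set.Icc 0 1) 0 = D
  -- The exponents `TDT` and `C = P(0)⁻¹P'(0) = TTD` are conjugate under `S`.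
  have e : t • (T * D * T) = S * (t • (T * T * D)) * T := by
    rw [mul_smul_comm, smul_mul_assoc, ← mul_assoc, ← mul_assoc, hST, one_mul]
  rw [e, exp_smul_units_conj hST hTS, ← mul_assoc S, mul_assoc _ T S, hTS, mul_one, ← mul_assoc S]

end Joining

end QuatCone

theorem mainTheorem10 (n : ℕ) (A B : QuatCone.Mat n)
    (hA : A ∈ QuatCone.cone n) (hB : B ∈ QuatCone.cone n) :
    QuatCone.IsGeodesicJoining A B
        (fun t : ℝ => QuatCone.rpow A (1 / 2)
          * QuatCone.rpow (QuatCone.rpow A (-(1 / 2)) * B * QuatCone.rpow A (-(1 / 2))) t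
          * QuatCone.rpow A (1 / 2)) ∧
      ∀ γ : ℝ → QuatCone.Mat n, QuatCone.IsGeodesicJoining A B γ →
        ∀ t ∈ Set.Icc (0 : ℝ) 1,
          γ t = QuatCone.rpow A (1 / 2)
            * QuatCone.rpow (QuatCone.rpow A (-(1 / 2)) * B * QuatCone.rpow A (-(1 / 2))) t
            * QuatCone.rpow A (1 / 2) := by
  have hC := QuatCone.mul_mul_mem_cone (QuatCone.rpow_mem_herm hA (-(1 / 2)))
    (QuatCone.isUnit_rpow A (-(1 / 2))) hB
  have hST := QuatCone.rpow_mul_rpow_neg A (1 / 2)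
  have hTS := QuatCone.rpow_neg_mul_rpow A (1 / 2)
  have hSS := QuatCone.rpow_half_mul_self hA
  have hTh := QuatCone.rpow_mem_herm hA (-(1 / 2))
  refine ⟨⟨QuatCone.isGeodesic_mul_exp_mul (QuatCone.rpow_mem_herm hA _)
    (QuatCone.isUnit_rpow A _) (QuatCone.log_mem_herm hC), ?_, ?_⟩, ?_⟩
  · change _ * QuatCone.rpow _ 0 * _ = _
    rw [QuatCone.rpow_zero, mul_one, hSS]
  · change _ * QuatCone.rpow _ 1 * _ = _
    rw [QuatCone.rpow_one hC, ← mul_assoc, ← mul_assoc, hST, one_mul, mul_assoc, hTS, mul_one]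
  · rintro γ ⟨hγ, h0, h1⟩ t ht
    have hexp := hγ.eq_mul_exp_mul hST hTS (h0.trans hSS.symm)
    have hH := QuatCone.mul_mul_mem_herm hTh
      (QuatCone.derivWithin_mem_herm (fun t ht => (hγ.2.1 ht).1) (Set.left_mem_Icc.2 zero_le_one))
    -- At `t = 1` the formula for `γ` reads `B = S exp(H) S`; `H` is Hermitian, so `log_exp`
    -- recovers it and the initial velocity is determined.
    have hlog : QuatCone.log (QuatCone.rpow A (-(1 / 2)) * B * QuatCone.rpow A (-(1 / 2)))
        = QuatCone.rpow A (-(1 / 2)) * derivWithin γ (Set.Icc 0 1) 0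
          * QuatCone.rpow A (-(1 / 2)) := by
      rw [← QuatCone.log_exp hH, ← h1, hexp 1 (Set.right_mem_Icc.2 zero_le_one), one_smul,
        ← mul_assoc, ← mul_assoc, hTS, one_mul, mul_assoc, hST, mul_one]
    rw [hexp t ht, ← hlog]
    rfl
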